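/- Let $n\ge 0$ be an integer. Let $\mathcal L^-\mathrm{GL}_n\mathbb R$ be the group, under multiplication, of all invertible $n\times n$ matrices $g$ of rational functions in $\mathbb C(\lambda)$ that have no pole at $\infty$, satisfy $g(\infty)=I$, and satisfy the reality condition $\overline{g(\bar\lambda)}=g(\lambda)$. For a direct sum decomposition of $\mathbb C^n$ into complex subspaces, let $\pi_V$ denote the projection onto the summand $V$ along the sum of the other summands, and let $\overline V=\{\bar v: v\in V\}$. Then $\mathcal L^-\mathrm{GL}_n\mathbb R$ is generated by the following loops, all of which belong to it: * $p_{\alpha,\beta,V,W}(\lambda)=\dfrac{\lambda-\alpha}{\lambda-\beta}\,\pi_V+\pi_W$, where $\alpha,\beta\in\mathbb R$, $\mathbb C^n=V\oplus W$, $\overline V=V$, $\overline W=W$; * $q_{\alpha,\beta,V,W}(\lambda)=\dfrac{(\lambda-\alpha)(\lambda-\bar\alpha)}{(\lambda-\beta)(\lambda-\bar\beta)}\,\pi_V+\pi_W$, where $\alpha,\beta\in\mathbb C$ with $\alpha\notin\mathbb R$ or $\beta\notin\mathbb R$, $\mathbb C^n=V\oplus W$, $\overline V=V$, $\overline W=W$;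 * $r_{\alpha,\beta,V,W}(\lambda)=\dfrac{\lambda-\alpha}{\lambda-\beta}\,\pi_V+\pi_W+\dfrac{\lambda-\bar\alpha}{\lambda-\bar\beta}\,\pi_{\overline V}$, where $\alpha,\beta\in\mathbb C$, $\mathbb C^n=V\oplus W\oplus\overline V$, $\overline W=W$. -/

import Mathlib

namespace RationalLoop

open scoped WithZero

open Classical in
/-- The valuation of `ℂ(λ)` at the point `∞ ∈ ℂP¹` (`f ≠ 0` has valuation `exp` of the degree of
its numerator minus the degree of its denominator). -/
noncomputable abbrev inftyVal : Valuation (RatFunc ℂ) ℤᵐ⁰ := RatFunc.inftyValuation ℂ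

/-- The rational function `f` has no pole at `∞ ∈ ℂP¹` and `f(∞) = c`; that is, `f - c` vanishes
at `∞` (it is `0`, or its numerator has smaller degree than its denominator). -/
def HasValueAtInfty (f : RatFunc ℂ) (c : ℂ) : Prop :=
  inftyVal (f - RatFunc.C c) < 1

/-- The matrix of rational functions `g` has no pole at `∞` and is normalized by `g(∞) = I`. -/
def IsNormalized {n : ℕ} (g : Matrix (Fin n) (Fin n) (RatFunc ℂ)) : Prop :=
  ∀ i j, HasValueAtInfty (g i j) ((1 : Matrix (Fin n) (Fin n) ℂ) i j)

lemma isNormalized_iff_residue {n : ℕ}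
    (g : Matrix (Fin n) (Fin n) inftyVal.valuationSubring) :
    IsNormalized (g.map (Subring.subtype inftyVal.valuationSubring.toSubring)) ↔
      g.map (IsLocalRing.residue inftyVal.valuationSubring) = 1 := by
  have h1 : (1 : Matrix (Fin n) (Fin n) (IsLocalRing.ResidueField inftyVal.valuationSubring)) =
      (1 : Matrix (Fin n) (Fin n) inftyVal.valuationSubring).map
        (IsLocalRing.residue inftyVal.valuationSubring) := by
    simp [Matrix.map_one]
  rw [h1, ← Matrix.ext_iff]
  refine forall_congr' fun i => forall_congr' fun j => ?_
  simp only [Matrix.map_apply]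
  rw [← sub_eq_zero (b := IsLocalRing.residue _ _), ← map_sub,
    IsLocalRing.residue_eq_zero_iff, ValuationSubring.valuation_lt_one_iff,
    ← (Valuation.isEquiv_valuation_valuationSubring inftyVal).lt_one_iff_lt_one]
  unfold HasValueAtInfty
  by_cases hij : i = j
  · subst hij; simp
  · simp [hij]

lemma IsNormalized.exists_lift {n : ℕ} {g : Matrix (Fin n) (Fin n) (RatFunc ℂ)}
    (hg : IsNormalized g) :
    ∃ g' : Matrix (Fin n) (Fin n) inftyVal.valuationSubring,
      g'.map (Subring.subtype inftyVal.valuationSubring.toSubring) = g := by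
  have key : ∀ i j, g i j ∈ inftyVal.valuationSubring := by
    intro i j
    rw [Valuation.mem_valuationSubring_iff]
    have h := hg i j
    unfold HasValueAtInfty at h
    have h2 : g i j = (g i j - RatFunc.C ((1 : Matrix (Fin n) (Fin n) ℂ) i j)) +
      RatFunc.C ((1 : Matrix (Fin n) (Fin n) ℂ) i j) := by ring
    rw [h2]
    refine (Valuation.map_add _ _ _).trans (max_le h.le ?_)
    by_cases hij : i = j <;> simp [hij, Matrix.one_apply]
  exact ⟨fun i j => ⟨g i j, key i j⟩, rfl⟩

/-- The full rational loop group: invertible `n × n` matrices of rational functions of `λ`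
with `g(∞) = I`. -/
def loopGroupComplex (n : ℕ) : Subgroup (GL (Fin n) (RatFunc ℂ)) where
  carrier := {g | IsNormalized (g : Matrix (Fin n) (Fin n) (RatFunc ℂ))}
  one_mem' := by
    intro i j
    unfold HasValueAtInfty
    by_cases hij : i = j <;> simp [hij, Matrix.one_apply]
  mul_mem' := by
    intro a b ha hb
    obtain ⟨a', ha'⟩ := IsNormalized.exists_lift ha
    obtain ⟨b', hb'⟩ := IsNormalized.exists_lift hb
    simp only [Set.mem_ofPred_eq] at ha hb ⊢
    rw [← ha', isNormalized_iff_residue] at ha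
    rw [← hb', isNormalized_iff_residue] at hb
    rw [Matrix.GeneralLinearGroup.coe_mul, ← ha', ← hb', ← Matrix.map_mul,
      isNormalized_iff_residue, Matrix.map_mul, ha, hb, one_mul]
  inv_mem' := by
    intro a ha
    obtain ⟨a', ha'⟩ := IsNormalized.exists_lift ha
    simp only [Set.mem_ofPred_eq] at ha ⊢
    rw [← ha', isNormalized_iff_residue] at ha
    have hdet : IsUnit a'.det := by
      apply IsLocalRing.residue_ne_zero_iff_isUnit _ |>.1
      rw [RingHom.map_det, RingHom.mapMatrix_apply, ha, Matrix.det_one]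
      exact one_ne_zero
    have hmul : a' * a'⁻¹ = 1 := Matrix.mul_nonsing_inv _ hdet
    have hinv : (a'⁻¹).map
        (Subring.subtype inftyVal.valuationSubring.toSubring) =
        ((a⁻¹ : GL (Fin n) (RatFunc ℂ)) : Matrix (Fin n) (Fin n) (RatFunc ℂ)) := by
      have h := congrArg (fun M => M.map
        (Subring.subtype inftyVal.valuationSubring.toSubring)) hmul
      simp only [Matrix.map_mul, ha'] at h
      rw [Matrix.map_one _ (map_zero _) (map_one _)] at h
      rw [Matrix.coe_units_inv]
      exact (Matrix.inv_eq_right_inv h).symm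
    rw [← hinv, isNormalized_iff_residue]
    have h := congrArg (fun M => M.map
      (IsLocalRing.residue inftyVal.valuationSubring)) hmul
    simp only [Matrix.map_mul, ha, one_mul] at h
    rw [h, Matrix.map_one _ (map_zero _) (map_one _)]

/-- The rational function `λ ↦ conj (f (conj λ))`, obtained from `f` by conjugating all
coefficients, as a ring homomorphism. -/
noncomputable def conjRatFunc : RatFunc ℂ →+* RatFunc ℂ :=
  RatFunc.mapRingHom (Polynomial.mapRingHom (starRingEnd ℂ)) (by
    intro p hp
    rw [Submonoid.mem_comap, mem_nonZeroDivisors_iff_ne_zero]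
    rw [mem_nonZeroDivisors_iff_ne_zero] at hp
    simpa [Polynomial.map_eq_zero] using hp)

/-- The rational loop group of `GL_n ℝ`: the loops `g` in the full rational loop group with
`conj (g (conj λ)) = g(λ)`. -/
noncomputable def loopGroupReal (n : ℕ) : Subgroup (GL (Fin n) (RatFunc ℂ)) :=
  loopGroupComplex n ⊓
    (Matrix.GeneralLinearGroup.map conjRatFunc).eqLocus (MonoidHom.id (GL (Fin n) (RatFunc ℂ)))

/-- The complex conjugate `V̄` of a complex subspace `V` of `ℂⁿ`. -/
def conjSubspace {n : ℕ} (V : Submodule ℂ (Fin n → ℂ)) : Submodule ℂ (Fin n → ℂ) where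
  carrier := {v | star v ∈ V}
  add_mem' := by
    intro a b ha hb
    simpa only [Set.mem_ofPred_eq, star_add] using V.add_mem ha hb
  zero_mem' := by simp
  smul_mem' := by
    intro c v hv
    simpa only [Set.mem_ofPred_eq, star_smul] using V.smul_mem (star c) hv

/-- The projection of `ℂⁿ` onto `V` along `K`, where `ℂⁿ = V ⊕ K`, as a matrix of constant
rational functions. -/
noncomputable def proj {n : ℕ} (V K : Submodule ℂ (Fin n → ℂ)) (h : IsCompl V K) :
    Matrix (Fin n) (Fin n) (RatFunc ℂ) :=
  (LinearMap.toMatrix' (V.projection K h)).map RatFunc.C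

/-- The rational function `(λ - α) / (λ - β)`. -/
noncomputable def ratio (α β : ℂ) : RatFunc ℂ :=
  (RatFunc.X - RatFunc.C α) / (RatFunc.X - RatFunc.C β)

/-- The simple elements `p_{α,β,V,W} = ((λ - α) / (λ - β)) π_V + π_W`, with `α, β ∈ ℝ`,
`ℂⁿ = V ⊕ W`, `V̄ = V`, `W̄ = W`. -/
def pLoops (n : ℕ) : Set (GL (Fin n) (RatFunc ℂ)) :=
  {g | ∃ (α β : ℝ) (V W : Submodule ℂ (Fin n → ℂ)) (h : IsCompl V W),
    conjSubspace V = V ∧ conjSubspace W = W ∧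
    (g : Matrix (Fin n) (Fin n) (RatFunc ℂ)) =
      ratio (α : ℂ) (β : ℂ) • proj V W h + proj W V h.symm}

open scoped ComplexConjugate in
/-- The simple elements
`q_{α,β,V,W} = ((λ - α)(λ - ᾱ) / ((λ - β)(λ - β̄))) π_V + π_W`, with `α ∉ ℝ` or `β ∉ ℝ`,
`ℂⁿ = V ⊕ W`, `V̄ = V`, `W̄ = W`. -/
def qLoops (n : ℕ) : Set (GL (Fin n) (RatFunc ℂ)) :=
  {g | ∃ (α β : ℂ) (V W : Submodule ℂ (Fin n → ℂ)) (h : IsCompl V W),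
    (α.im ≠ 0 ∨ β.im ≠ 0) ∧ conjSubspace V = V ∧ conjSubspace W = W ∧
    (g : Matrix (Fin n) (Fin n) (RatFunc ℂ)) =
      (((RatFunc.X - RatFunc.C α) * (RatFunc.X - RatFunc.C (conj α))) /
        ((RatFunc.X - RatFunc.C β) * (RatFunc.X - RatFunc.C (conj β)))) • proj V W h +
        proj W V h.symm}

open scoped ComplexConjugate in
/-- The simple elements
`r_{α,β,V,W} = ((λ - α) / (λ - β)) π_V + π_W + ((λ - ᾱ) / (λ - β̄)) π_V̄`, with
`ℂⁿ = V ⊕ W ⊕ V̄` and `W̄ = W`. The direct sum of three subspaces is expressed by each of them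
being a complement of the sum of the other two, along which the projection is taken. -/
def rLoops (n : ℕ) : Set (GL (Fin n) (RatFunc ℂ)) :=
  {g | ∃ (α β : ℂ) (V W : Submodule ℂ (Fin n → ℂ))
    (hV : IsCompl V (W ⊔ conjSubspace V)) (hW : IsCompl W (V ⊔ conjSubspace V))
    (hV' : IsCompl (conjSubspace V) (V ⊔ W)),
    conjSubspace W = W ∧
    (g : Matrix (Fin n) (Fin n) (RatFunc ℂ)) =
      ratio α β • proj V (W ⊔ conjSubspace V) hV + proj W (V ⊔ conjSubspace V) hW +
        ratio (conj α) (conj β) • proj (conjSubspace V) (V ⊔ W) hV'}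

end RationalLoop

namespace RationalLoop

open scoped WithZero ComplexConjugate
open Polynomial

/-! That the simple elements lie in the group is a check on `g - 1`, whose entries must vanish at
infinity, and on conjugation, which permutes the projections involved.

Generation is Gaussian elimination by columns. If the first `m` columns of `g` are those of the
identity, let `x` be the next column of `g - 1`, placed in a matrix `s = 1 + ∑ i, x i E_ik`. Then
`s` and `g` agree on the first `m + 1` columns, so `s⁻¹ g` has one more trivial column. The entries
of `x` are real and vanish at infinity, so no pivoting or division is needed
(`mem_simpleSubgroup_of_columns`).

The matrix `s` is a product of factors `1 + f E_ik`. These come from idempotents: for real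
idempotent `Q`, `1 + f Q` is `u π_V + π_W` with `u = 1 + f`, and an off-diagonal factor is a
quotient of two such matrices (`one_add_single_mem`). Finally `u π_V + π_W` is multiplicative in
`u`, and `u` is a quotient of real monic polynomials of equal degree, which split into real linear
and quadratic factors (`smul_proj_mem`). Only the `p` and `q` loops are needed for generation. -/

/-! ### Conjugation and the valuation at infinity -/

lemma conjRatFunc_algebraMap (p : ℂ[X]) :
    conjRatFunc (algebraMap ℂ[X] (RatFunc ℂ) p) =
      algebraMap ℂ[X] (RatFunc ℂ) (p.map (starRingEnd ℂ)) := by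
  rw [conjRatFunc, RatFunc.coe_mapRingHom_eq_coe_map]
  simpa using RatFunc.map_apply_div (K := ℂ) (Polynomial.mapRingHom (starRingEnd ℂ)) _ p 1

lemma conjRatFunc_C (c : ℂ) : conjRatFunc (RatFunc.C c) = RatFunc.C (conj c) := by
  rw [← RatFunc.algebraMap_C, conjRatFunc_algebraMap, Polynomial.map_C, RatFunc.algebraMap_C]

lemma conjRatFunc_X : conjRatFunc RatFunc.X = RatFunc.X := by
  rw [← RatFunc.algebraMap_X, conjRatFunc_algebraMap, Polynomial.map_X]

lemma conjRatFunc_ratio (α β : ℂ) : conjRatFunc (ratio α β) = ratio (conj α) (conj β) := by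
  simp [ratio, conjRatFunc_C, conjRatFunc_X]

lemma mem_loopGroupReal_iff {n : ℕ} {g : GL (Fin n) (RatFunc ℂ)} :
    g ∈ loopGroupReal n ↔
      (∀ i j, inftyVal (((g : Matrix (Fin n) (Fin n) (RatFunc ℂ)) - 1) i j) < 1) ∧
        (g : Matrix (Fin n) (Fin n) (RatFunc ℂ)).map conjRatFunc = g := by
  have h1 : ∀ i j, RatFunc.C ((1 : Matrix (Fin n) (Fin n) ℂ) i j) =
      (1 : Matrix (Fin n) (Fin n) (RatFunc ℂ)) i j := by
    intro i j
    by_cases h : i = j <;> simp [h, Matrix.one_apply]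
  refine and_congr ?_ ?_
  · change IsNormalized _ ↔ _
    simp only [IsNormalized, HasValueAtInfty, h1, Matrix.sub_apply]
  · exact Units.ext_iff

lemma X_sub_C_ne_zero (a : ℂ) : (RatFunc.X - RatFunc.C a : RatFunc ℂ) ≠ 0 := by
  rw [← RatFunc.algebraMap_X, ← RatFunc.algebraMap_C, ← map_sub]
  exact RatFunc.algebraMap_ne_zero (Polynomial.X_sub_C_ne_zero a)

lemma inftyVal_div_sub_one_lt {p q : ℂ[X]} (hp : p.Monic) (hq : q.Monic)
    (h : p.natDegree = q.natDegree) :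
    inftyVal (algebraMap ℂ[X] (RatFunc ℂ) p / algebraMap ℂ[X] (RatFunc ℂ) q - 1) < 1 := by
  classical
  have hq0 := RatFunc.algebraMap_ne_zero hq.ne_zero
  rw [div_sub_one hq0, ← map_sub]
  by_cases hpq : p - q = 0
  · simp [hpq]
  -- Both leading terms are monic of the same degree and cancel.
  have hd : (p - q).natDegree < q.natDegree := by
    apply natDegree_lt_natDegree hpq
    rw [← degree_eq_iff_natDegree_eq hp.ne_zero |>.2 (h.trans rfl) |>.trans
      (degree_eq_natDegree hq.ne_zero).symm]
    exact degree_sub_lt_left (by rw [degree_eq_natDegree hp.ne_zero, degree_eq_natDegree hq.ne_zero, h])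
      hp.ne_zero (by rw [hp.leadingCoeff, hq.leadingCoeff])
  rw [map_div₀]
  simp only [RatFunc.inftyValuation_apply, RatFunc.inftyValuation.polynomial _ hpq,
    RatFunc.inftyValuation.polynomial _ hq.ne_zero]
  rw [div_lt_one₀ (by simp)]
  simpa using hd

lemma ratio_eq (α β : ℂ) : ratio α β =
    algebraMap ℂ[X] (RatFunc ℂ) (X - C α) / algebraMap ℂ[X] (RatFunc ℂ) (X - C β) := by
  simp [ratio]

lemma inftyVal_ratio_sub_one_lt (α β : ℂ) : inftyVal (ratio α β - 1) < 1 := by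
  rw [ratio_eq]
  exact inftyVal_div_sub_one_lt (monic_X_sub_C _) (monic_X_sub_C _) (by simp)

lemma inftyVal_C_le_one (c : ℂ) : inftyVal (RatFunc.C c) ≤ 1 := by
  classical
  by_cases hc : c = 0
  · simp [hc]
  · exact (RatFunc.inftyValuation.C _ hc).le

lemma inftyVal_mul_C_lt_one {f : RatFunc ℂ} (hf : inftyVal f < 1) (c : ℂ) :
    inftyVal (f * RatFunc.C c) < 1 := by
  rw [map_mul]
  exact mul_lt_one_of_lt_of_le hf (inftyVal_C_le_one c)

/-! ### Conjugate subspaces and projections -/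

lemma mem_conjSubspace {n : ℕ} {V : Submodule ℂ (Fin n → ℂ)} {v : Fin n → ℂ} :
    v ∈ conjSubspace V ↔ star v ∈ V := Iff.rfl

lemma conjSubspace_conjSubspace {n : ℕ} (V : Submodule ℂ (Fin n → ℂ)) :
    conjSubspace (conjSubspace V) = V := by
  ext v; simp [mem_conjSubspace]

lemma conjSubspace_mono {n : ℕ} {V W : Submodule ℂ (Fin n → ℂ)} (h : V ≤ W) :
    conjSubspace V ≤ conjSubspace W := fun _ hv => h hv

lemma conjSubspace_sup {n : ℕ} (V W : Submodule ℂ (Fin n → ℂ)) :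
    conjSubspace (V ⊔ W) = conjSubspace V ⊔ conjSubspace W := by
  apply le_antisymm
  · rw [← conjSubspace_conjSubspace (conjSubspace V ⊔ conjSubspace W)]
    apply conjSubspace_mono
    refine sup_le ?_ ?_
    · rw [← conjSubspace_conjSubspace V]
      exact conjSubspace_mono (by rw [conjSubspace_conjSubspace]; exact le_sup_left)
    · rw [← conjSubspace_conjSubspace W]
      exact conjSubspace_mono (by rw [conjSubspace_conjSubspace]; exact le_sup_right)
  · exact sup_le (conjSubspace_mono le_sup_left) (conjSubspace_mono le_sup_right)

/-- Conjugating the decomposition of `x` along `V` and `K` gives that of `star x` along the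
conjugates. Standard basis vectors are real, so this can be read off entrywise. -/
lemma proj_map_conjRatFunc {n : ℕ} {V K V' K' : Submodule ℂ (Fin n → ℂ)} (h : IsCompl V K)
    (h' : IsCompl V' K') (hV : conjSubspace V = V') (hK : conjSubspace K = K') :
    (proj V K h).map conjRatFunc = proj V' K' h' := by
  subst hV hK
  have key : ∀ x, star (V.projection K h x) =
      (conjSubspace V).projection (conjSubspace K) h' (star x) := by
    intro x
    have hx : star x = star (V.projection K h x) + star (x - V.projection K h x) := by
      rw [← star_add]; simp
    rw [hx, map_add, Submodule.projection_apply_of_mem_left h',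
      Submodule.projection_apply_of_mem_right h', add_zero]
    · rw [mem_conjSubspace, star_star]
      exact Submodule.sub_projection_mem h x
    · rw [mem_conjSubspace, star_star]
      exact Submodule.projection_apply_mem h x
  ext i j : 1
  simp only [proj, Matrix.map_apply, LinearMap.toMatrix'_apply, conjRatFunc_C]
  have h1 := congrFun (key (Pi.single j 1)) i
  rw [← Pi.single_star, star_one] at h1
  rw [← h1]
  rfl

lemma proj_add_proj {n : ℕ} {V W : Submodule ℂ (Fin n → ℂ)} (h : IsCompl V W) :
    proj V W h + proj W V h.symm = 1 := by
  have h1 := congrArg LinearMap.toMatrix' (Submodule.projection_add_projection_eq_id h)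
  rw [map_add, LinearMap.toMatrix'_id] at h1
  rw [proj, proj, ← Matrix.map_add _ (map_add _), h1, Matrix.map_one _ (map_zero _) (map_one _)]

lemma proj_mul_self {n : ℕ} {V W : Submodule ℂ (Fin n → ℂ)} (h : IsCompl V W) :
    proj V W h * proj V W h = proj V W h := by
  have h1 := Submodule.isIdempotentElem_projection h
  rw [proj, ← Matrix.map_mul, ← LinearMap.toMatrix'_mul, h1.eq]

lemma proj_add_proj_add_proj {n : ℕ} {U V W : Submodule ℂ (Fin n → ℂ)} (hU : IsCompl U (V ⊔ W))
    (hV : IsCompl V (U ⊔ W)) (hW : IsCompl W (U ⊔ V)) :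
    proj U (V ⊔ W) hU + proj V (U ⊔ W) hV + proj W (U ⊔ V) hW = 1 := by
  have key : U.projection _ hU + V.projection _ hV + W.projection _ hW = LinearMap.id := by
    rw [← LinearMap.eqLocus_eq_top, eq_top_iff, ← hU.sup_eq_top]
    refine sup_le ?_ (sup_le ?_ ?_) <;> intro x hx
    · have h1 : x ∈ U ⊔ W := Submodule.mem_sup_left hx
      have h2 : x ∈ U ⊔ V := Submodule.mem_sup_left hx
      simp [LinearMap.mem_eqLocus, (Submodule.projection_eq_self_iff hU x).2 hx,
        (Submodule.projection_apply_eq_zero_iff hV).2 h1,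
        (Submodule.projection_apply_eq_zero_iff hW).2 h2]
    · have h1 : x ∈ V ⊔ W := Submodule.mem_sup_left hx
      have h2 : x ∈ U ⊔ V := Submodule.mem_sup_right hx
      simp [LinearMap.mem_eqLocus, (Submodule.projection_eq_self_iff hV x).2 hx,
        (Submodule.projection_apply_eq_zero_iff hU).2 h1,
        (Submodule.projection_apply_eq_zero_iff hW).2 h2]
    · have h1 : x ∈ V ⊔ W := Submodule.mem_sup_right hx
      have h2 : x ∈ U ⊔ W := Submodule.mem_sup_right hx
      simp [LinearMap.mem_eqLocus, (Submodule.projection_eq_self_iff hW x).2 hx,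
        (Submodule.projection_apply_eq_zero_iff hU).2 h1,
        (Submodule.projection_apply_eq_zero_iff hV).2 h2]
  have h1 := congrArg LinearMap.toMatrix' key
  rw [map_add, map_add, LinearMap.toMatrix'_id] at h1
  rw [proj, proj, proj, ← Matrix.map_add _ (map_add _), ← Matrix.map_add _ (map_add _), h1,
    Matrix.map_one _ (map_zero _) (map_one _)]

/-! ### Simple elements belong to the real loop group -/

lemma smul_proj_add_proj {n : ℕ} {V W : Submodule ℂ (Fin n → ℂ)} (h : IsCompl V W)
    (u : RatFunc ℂ) : u • proj V W h + proj W V h.symm = 1 + (u - 1) • proj V W h := by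
  rw [← proj_add_proj h, sub_smul, one_smul]; abel

lemma mem_loopGroupReal_of_smul_proj {n : ℕ} {g : GL (Fin n) (RatFunc ℂ)} {u : RatFunc ℂ}
    {V W : Submodule ℂ (Fin n → ℂ)} (h : IsCompl V W) (hV : conjSubspace V = V)
    (hW : conjSubspace W = W) (hu : inftyVal (u - 1) < 1) (hu' : conjRatFunc u = u)
    (hg : (g : Matrix (Fin n) (Fin n) (RatFunc ℂ)) = u • proj V W h + proj W V h.symm) :
    g ∈ loopGroupReal n := by
  rw [mem_loopGroupReal_iff]
  constructor
  · intro i j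
    rw [hg, smul_proj_add_proj, add_sub_cancel_left, Matrix.smul_apply, smul_eq_mul]
    exact inftyVal_mul_C_lt_one hu _
  · rw [hg, Matrix.map_add _ (map_add _), Matrix.map_smul' _ _ _ (map_mul _), hu',
      proj_map_conjRatFunc h h hV hW, proj_map_conjRatFunc h.symm h.symm hW hV]

lemma pLoops_subset (n : ℕ) : pLoops n ⊆ loopGroupReal n := by
  rintro g ⟨α, β, V, W, h, hV, hW, hg⟩
  exact mem_loopGroupReal_of_smul_proj h hV hW (inftyVal_ratio_sub_one_lt _ _)
    (by simp [conjRatFunc_ratio]) hg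

lemma qLoops_subset (n : ℕ) : qLoops n ⊆ loopGroupReal n := by
  rintro g ⟨α, β, V, W, h, -, hV, hW, hg⟩
  refine mem_loopGroupReal_of_smul_proj h hV hW ?_ ?_ hg
  · have := inftyVal_div_sub_one_lt ((monic_X_sub_C α).mul (monic_X_sub_C (conj α)))
      ((monic_X_sub_C β).mul (monic_X_sub_C (conj β)))
      (by rw [(monic_X_sub_C α).natDegree_mul (monic_X_sub_C _),
        (monic_X_sub_C β).natDegree_mul (monic_X_sub_C _)]; simp)
    simpa using this
  · simp [conjRatFunc_C, conjRatFunc_X, mul_comm]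

lemma rLoops_subset (n : ℕ) : rLoops n ⊆ loopGroupReal n := by
  rintro g ⟨α, β, V, W, hV, hW, hV', hWW, hg⟩
  rw [SetLike.mem_coe, mem_loopGroupReal_iff]
  constructor
  · intro i j
    have h1 := proj_add_proj_add_proj hV hW hV'
    have h2 : (g : Matrix (Fin n) (Fin n) (RatFunc ℂ)) - 1 =
        (ratio α β - 1) • proj V (W ⊔ conjSubspace V) hV +
        (ratio (conj α) (conj β) - 1) • proj (conjSubspace V) (V ⊔ W) hV' := by
      rw [hg, ← h1, sub_smul, sub_smul, one_smul, one_smul]; abel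
    rw [h2, Matrix.add_apply]
    refine Valuation.map_add_lt _ ?_ ?_
    · exact inftyVal_mul_C_lt_one (inftyVal_ratio_sub_one_lt _ _) _
    · exact inftyVal_mul_C_lt_one (inftyVal_ratio_sub_one_lt _ _) _
  · have e1 : (proj V (W ⊔ conjSubspace V) hV).map conjRatFunc =
        proj (conjSubspace V) (V ⊔ W) hV' :=
      proj_map_conjRatFunc _ _ rfl
        (by rw [conjSubspace_sup, hWW, conjSubspace_conjSubspace, sup_comm])
    have e2 : (proj W (V ⊔ conjSubspace V) hW).map conjRatFunc =
        proj W (V ⊔ conjSubspace V) hW :=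
      proj_map_conjRatFunc _ _ hWW
        (by rw [conjSubspace_sup, conjSubspace_conjSubspace, sup_comm])
    have e3 : (proj (conjSubspace V) (V ⊔ W) hV').map conjRatFunc =
        proj V (W ⊔ conjSubspace V) hV :=
      proj_map_conjRatFunc _ _ (conjSubspace_conjSubspace V)
        (by rw [conjSubspace_sup, hWW, sup_comm])
    rw [hg, Matrix.map_add _ (map_add _), Matrix.map_add _ (map_add _),
      Matrix.map_smul' _ _ _ (map_mul _), Matrix.map_smul' _ _ _ (map_mul _), e1, e2, e3,
      conjRatFunc_ratio, conjRatFunc_ratio, Complex.conj_conj, Complex.conj_conj]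
    abel

/-! ### Scalar loops on a real decomposition -/

/-- The subgroup generated by the simple elements `p`, `q` and `r`. -/
noncomputable def simpleSubgroup (n : ℕ) : Subgroup (GL (Fin n) (RatFunc ℂ)) :=
  Subgroup.closure (pLoops n ∪ qLoops n ∪ rLoops n)

lemma simpleSubgroup_le (n : ℕ) : simpleSubgroup n ≤ loopGroupReal n :=
  (Subgroup.closure_le _).2
    (Set.union_subset (Set.union_subset (pLoops_subset n) (qLoops_subset n)) (rLoops_subset n))

/-- The matrices underlying elements of `simpleSubgroup n`. -/
noncomputable def simpleMatrices (n : ℕ) : Submonoid (Matrix (Fin n) (Fin n) (RatFunc ℂ)) :=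
  (simpleSubgroup n).toSubmonoid.map (Units.coeHom _)

/-- Provides inverses in a mere submonoid of matrices: `N` is forced to be the matrix of `g⁻¹`. -/
lemma mem_simpleMatrices_of_mul_eq_one {n : ℕ} {M N : Matrix (Fin n) (Fin n) (RatFunc ℂ)}
    (hM : M ∈ simpleMatrices n) (h : M * N = 1) : N ∈ simpleMatrices n := by
  obtain ⟨g, hg, rfl⟩ := hM
  exact ⟨g⁻¹, (simpleSubgroup n).inv_mem hg, Units.inv_eq_of_mul_eq_one_right h⟩

lemma smul_proj_add_proj_mul {n : ℕ} {V W : Submodule ℂ (Fin n → ℂ)} (h : IsCompl V W)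
    (u v : RatFunc ℂ) :
    (u • proj V W h + proj W V h.symm) * (v • proj V W h + proj W V h.symm) =
      (u * v) • proj V W h + proj W V h.symm := by
  simp only [smul_proj_add_proj, mul_add, add_mul, mul_one, one_mul, smul_mul_smul_comm,
    proj_mul_self]
  rw [add_assoc, ← add_smul, ← add_smul]
  congr 2
  ring

lemma isUnit_smul_proj_add_proj {n : ℕ} {V W : Submodule ℂ (Fin n → ℂ)} (h : IsCompl V W)
    {u : RatFunc ℂ} (hu : u ≠ 0) : IsUnit (u • proj V W h + proj W V h.symm) := by
  refine IsUnit.of_mul_eq_one (u⁻¹ • proj V W h + proj W V h.symm) ?_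
  rw [smul_proj_add_proj_mul, mul_inv_cancel₀ hu, one_smul, proj_add_proj]

lemma ratio_smul_proj_mem {n : ℕ} {V W : Submodule ℂ (Fin n → ℂ)} (h : IsCompl V W)
    (hV : conjSubspace V = V) (hW : conjSubspace W = W) (α β : ℝ) :
    ratio α β • proj V W h + proj W V h.symm ∈ simpleMatrices n := by
  obtain ⟨g, hg⟩ := isUnit_smul_proj_add_proj h
    (div_ne_zero (X_sub_C_ne_zero (α : ℂ)) (X_sub_C_ne_zero (β : ℂ)))
  exact ⟨g, Subgroup.subset_closure (.inl (.inl ⟨α, β, V, W, h, hV, hW, hg⟩)), hg⟩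

lemma quadratic_smul_proj_mem {n : ℕ} {V W : Submodule ℂ (Fin n → ℂ)} (h : IsCompl V W)
    (hV : conjSubspace V = V) (hW : conjSubspace W = W) {α : ℂ} (hα : α.im ≠ 0) :
    (((RatFunc.X - RatFunc.C α) * (RatFunc.X - RatFunc.C (conj α))) / RatFunc.X ^ 2) •
      proj V W h + proj W V h.symm ∈ simpleMatrices n := by
  obtain ⟨g, hg⟩ := isUnit_smul_proj_add_proj h
    (div_ne_zero (mul_ne_zero (X_sub_C_ne_zero α) (X_sub_C_ne_zero (conj α)))
      (pow_ne_zero 2 RatFunc.X_ne_zero))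
  refine ⟨g, Subgroup.subset_closure (.inl (.inr ⟨α, 0, V, W, h, .inl hα, hV, hW, ?_⟩)), hg⟩
  rw [hg, map_zero (starRingEnd ℂ), map_zero RatFunc.C, sub_zero, sq]

lemma map_conj_of_mul {r s : ℂ[X]} (hr : r ≠ 0) (hr' : r.map (starRingEnd ℂ) = r)
    (h : (r * s).map (starRingEnd ℂ) = r * s) : s.map (starRingEnd ℂ) = s := by
  rw [Polynomial.map_mul, hr'] at h
  exact mul_left_cancel₀ hr h

/-- Putting all poles at `0` lets each real irreducible factor of `p` be treated separately: a real
root gives a `p` loop, a conjugate pair a `q` loop, both with `β = 0`. -/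
lemma polynomial_div_X_pow_smul_proj_mem {n : ℕ} {V W : Submodule ℂ (Fin n → ℂ)}
    (h : IsCompl V W) (hV : conjSubspace V = V) (hW : conjSubspace W = W) (p : ℂ[X])
    (hp : p.Monic) (hp' : p.map (starRingEnd ℂ) = p) :
    (algebraMap ℂ[X] (RatFunc ℂ) p / RatFunc.X ^ p.natDegree) • proj V W h + proj W V h.symm ∈
      simpleMatrices n := by
  induction hd : p.natDegree using Nat.strong_induction_on generalizing p with
  | _ d ih =>
    -- Splits off a real monic factor `r`; the cofactor is again real and monic, of smaller degree.
    have step : ∀ r s : ℂ[X], r.Monic → 0 < r.natDegree → r.map (starRingEnd ℂ) = r → p = r * s →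
        (algebraMap ℂ[X] (RatFunc ℂ) r / RatFunc.X ^ r.natDegree) • proj V W h +
          proj W V h.symm ∈ simpleMatrices n →
        (algebraMap ℂ[X] (RatFunc ℂ) p / RatFunc.X ^ d) • proj V W h + proj W V h.symm ∈
          simpleMatrices n := by
      intro r s hr hr0 hr' hps hmem
      subst hps
      have hs : s.Monic := hr.of_mul_monic_left hp
      have hd' : d = r.natDegree + s.natDegree := by rw [← hd, hr.natDegree_mul hs]
      have := mul_mem hmem (ih s.natDegree (by omega) s hs (map_conj_of_mul hr.ne_zero hr' hp') rfl)
      rwa [smul_proj_add_proj_mul, div_mul_div_comm, ← map_mul, ← pow_add, ← hd'] at this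
    rcases Nat.eq_zero_or_pos d with hd0 | hd0
    · subst hd0
      rw [hp.natDegree_eq_zero.1 hd, map_one, pow_zero, div_one, one_smul, proj_add_proj]
      exact one_mem _
    obtain ⟨a, ha⟩ := Complex.exists_root (f := p) (natDegree_pos_iff_degree_pos.1 (hd ▸ hd0))
    obtain ⟨s, hs⟩ := dvd_iff_isRoot.2 ha
    by_cases him : a.im = 0
    · have hconj : conj a = a := Complex.conj_eq_iff_im.2 him
      refine step _ s (monic_X_sub_C a) (by simp) (by simp [hconj]) hs ?_
      have := ratio_smul_proj_mem h hV hW a.re 0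
      rw [Complex.conj_eq_iff_re.1 hconj] at this
      simpa [ratio] using this
    · have hne : a ≠ conj a := fun h => him (Complex.conj_eq_iff_im.1 h.symm)
      have ha' : p.IsRoot (conj a) := by
        have := ha.map (f := starRingEnd ℂ)
        rwa [hp'] at this
      -- The linear factors at `a` and `conj a` are coprime, so their real product divides `p`.
      obtain ⟨t, ht⟩ := (isCoprime_X_sub_C_of_isUnit_sub
        (sub_ne_zero.2 hne).isUnit).mul_dvd (dvd_iff_isRoot.2 ha) (dvd_iff_isRoot.2 ha')
      have hdeg : ((X - C a) * (X - C (conj a))).natDegree = 2 := by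
        rw [(monic_X_sub_C a).natDegree_mul (monic_X_sub_C _)]; simp
      refine step _ t ((monic_X_sub_C a).mul (monic_X_sub_C _)) (by omega)
        (by simp [mul_comm]) ht ?_
      rw [hdeg]
      simpa using quadratic_smul_proj_mem h hV hW him

/-- Multiplying numerator and denominator by the conjugate of the denominator makes the denominator
`q` real; then `p = u q` is real too. Since `u - 1` vanishes at infinity, `p - q` has smaller degree
than `q`, so `p` inherits its leading term. -/
lemma exists_monic_real_div {u : RatFunc ℂ} (hu : inftyVal (u - 1) < 1)
    (hu' : conjRatFunc u = u) :
    ∃ p q : ℂ[X], p.Monic ∧ q.Monic ∧ p.natDegree = q.natDegree ∧ p.map (starRingEnd ℂ) = p ∧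
      q.map (starRingEnd ℂ) = q ∧
      u = algebraMap ℂ[X] (RatFunc ℂ) p / algebraMap ℂ[X] (RatFunc ℂ) q := by
  classical
  set d := u.denom with hd
  have hd1 : d.Monic := RatFunc.monic_denom u
  set q := d * d.map (starRingEnd ℂ) with hq
  set p := u.num * d.map (starRingEnd ℂ) with hp
  have hd2 : (d.map (starRingEnd ℂ)).Monic := hd1.map _
  have hq1 : q.Monic := hd1.mul hd2
  have hq2 : q.map (starRingEnd ℂ) = q := by
    rw [hq, Polynomial.map_mul, Polynomial.map_map, mul_comm]
    simp
  have hq0 := RatFunc.algebraMap_ne_zero hq1.ne_zero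
  have hupq : u = algebraMap ℂ[X] (RatFunc ℂ) p / algebraMap ℂ[X] (RatFunc ℂ) q := by
    rw [hp, hq, map_mul, map_mul,
      mul_div_mul_right _ _ (RatFunc.algebraMap_ne_zero hd2.ne_zero), hd, RatFunc.num_div_denom]
  have hp2 : p.map (starRingEnd ℂ) = p := by
    apply RatFunc.algebraMap_injective ℂ
    rw [← conjRatFunc_algebraMap]
    have h1 : algebraMap ℂ[X] (RatFunc ℂ) p = u * algebraMap ℂ[X] (RatFunc ℂ) q := by
      rw [hupq, div_mul_cancel₀ _ hq0]
    rw [h1, map_mul, hu', conjRatFunc_algebraMap, hq2]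
  have hlt : (p - q).degree < q.degree := by
    by_cases hpq : p - q = 0
    · rw [hpq, degree_zero]
      exact bot_lt_iff_ne_bot.2 (degree_eq_bot.not.2 hq1.ne_zero)
    rw [hupq, div_sub_one hq0, ← map_sub, map_div₀] at hu
    simp only [RatFunc.inftyValuation_apply, RatFunc.inftyValuation.polynomial _ hpq,
      RatFunc.inftyValuation.polynomial _ hq1.ne_zero] at hu
    rw [div_lt_one₀ (by simp)] at hu
    rw [degree_eq_natDegree hpq, degree_eq_natDegree hq1.ne_zero]
    simpa using hu
  have hpq : p = q + (p - q) := by ring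
  refine ⟨p, q, ?_, hq1, ?_, hp2, hq2, hupq⟩
  · rw [hpq]; exact hq1.add_of_left hlt
  · rw [hpq]; exact natDegree_eq_of_degree_eq (degree_add_eq_left_of_degree_lt hlt)

lemma smul_proj_mem {n : ℕ} {V W : Submodule ℂ (Fin n → ℂ)} (h : IsCompl V W)
    (hV : conjSubspace V = V) (hW : conjSubspace W = W) {u : RatFunc ℂ}
    (hu : inftyVal (u - 1) < 1) (hu' : conjRatFunc u = u) :
    u • proj V W h + proj W V h.symm ∈ simpleMatrices n := by
  obtain ⟨p, q, hp, hq, hpq, hp', hq', rfl⟩ := exists_monic_real_div hu hu'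
  have h1 := polynomial_div_X_pow_smul_proj_mem h hV hW p hp hp'
  have h2 := polynomial_div_X_pow_smul_proj_mem h hV hW q hq hq'
  have hX : (RatFunc.X : RatFunc ℂ) ^ q.natDegree ≠ 0 := pow_ne_zero _ RatFunc.X_ne_zero
  have hq0 := RatFunc.algebraMap_ne_zero hq.ne_zero
  rw [hpq] at h1
  have h3 := mul_mem h1 (mem_simpleMatrices_of_mul_eq_one h2
    (N := (algebraMap ℂ[X] (RatFunc ℂ) q / RatFunc.X ^ q.natDegree)⁻¹ • proj V W h +
      proj W V h.symm)
    (by rw [smul_proj_add_proj_mul, mul_inv_cancel₀ (div_ne_zero hq0 hX), one_smul,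
      proj_add_proj]))
  rw [smul_proj_add_proj_mul] at h3
  convert h3 using 3
  field_simp

/-! ### Elementary matrices from real idempotents -/

lemma one_add_smul_idempotent_mem {n : ℕ} {Q : Matrix (Fin n) (Fin n) ℂ}
    (hQ : IsIdempotentElem Q) (hQ' : Q.map (starRingEnd ℂ) = Q) {f : RatFunc ℂ}
    (hf : inftyVal f < 1) (hf' : conjRatFunc f = f) :
    1 + f • Q.map RatFunc.C ∈ simpleMatrices n := by
  have hT : IsIdempotentElem (Matrix.toLin' Q) := by
    rw [IsIdempotentElem, Module.End.mul_eq_comp, ← Matrix.toLin'_mul, hQ.eq]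
  -- A real matrix commutes with conjugation, so its range and kernel are conjugation-stable.
  have hstar : ∀ x, star (Matrix.toLin' Q x) = Matrix.toLin' Q (star x) := by
    intro x
    ext i
    conv_rhs => rw [← hQ']
    simp [Matrix.mulVec, dotProduct]
  have h := LinearMap.IsIdempotentElem.isCompl hT
  have hproj : proj _ _ h = Q.map RatFunc.C := by
    rw [proj, ← LinearMap.IsIdempotentElem.eq_projection hT, LinearMap.toMatrix'_toLin']
  rw [← hproj]
  have := smul_proj_mem h (u := 1 + f) ?_ ?_ (by simpa using hf) (by simp [hf'])
  · rwa [smul_proj_add_proj, add_sub_cancel_left] at this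
  · ext x
    simp only [mem_conjSubspace, LinearMap.mem_range]
    constructor
    · rintro ⟨y, hy⟩
      exact ⟨star y, by rw [← hstar, hy, star_star]⟩
    · rintro ⟨y, rfl⟩
      exact ⟨star y, (hstar y).symm⟩
  · ext x
    simp only [mem_conjSubspace, LinearMap.mem_ker]
    rw [← hstar, star_eq_zero]

lemma one_add_single_self_mem {n : ℕ} (k : Fin n) {f : RatFunc ℂ}
    (hf : inftyVal f < 1) (hf' : conjRatFunc f = f) :
    1 + Matrix.single k k f ∈ simpleMatrices n := by
  have := one_add_smul_idempotent_mem (Q := Matrix.single k k 1) (by simp [IsIdempotentElem])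
    (by simp [Matrix.map_single]) hf hf'
  simpa [Matrix.map_single, Matrix.smul_single] using this

/-- `E_ii + E_ik` is idempotent although `E_ik` is not, and `(1 + f (E_ii + E_ik)) (1 + f E_ii)⁻¹ =
1 + f E_ik` because `E_ik E_ii = 0`. -/
lemma one_add_single_mem {n : ℕ} {i k : Fin n} (hik : i ≠ k) {f : RatFunc ℂ}
    (hf : inftyVal f < 1) (hf' : conjRatFunc f = f) :
    1 + Matrix.single i k f ∈ simpleMatrices n := by
  have h1 := one_add_smul_idempotent_mem (n := n)
    (Q := Matrix.single i i 1 + Matrix.single i k 1)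
    (by simp [IsIdempotentElem, mul_add, add_mul, hik.symm])
    (by rw [Matrix.map_add _ (map_add _)]; simp [Matrix.map_single]) hf hf'
  have h2 := one_add_single_self_mem i hf hf'
  -- Otherwise `f = -1`, which does not vanish at infinity.
  have hf1 : 1 + f ≠ 0 := by
    intro h0
    rw [eq_neg_of_add_eq_zero_right h0, Valuation.map_neg, map_one] at hf
    exact lt_irrefl _ hf
  have h3 := mem_simpleMatrices_of_mul_eq_one h2 (N := 1 + Matrix.single i i ((1 + f)⁻¹ - 1)) (by
    simp only [mul_add, add_mul, mul_one, one_mul, Matrix.single_mul_single_same, add_assoc,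
      ← Matrix.single_add]
    convert add_zero (1 : Matrix (Fin n) (Fin n) (RatFunc ℂ))
    convert Matrix.single_zero i i
    field_simp
    ring)
  have h4 := mul_mem h1 h3
  rw [Matrix.map_add _ (map_add _), Matrix.map_single, Matrix.map_single, map_one, smul_add,
    Matrix.smul_single, Matrix.smul_single, smul_eq_mul, mul_one] at h4
  convert h4 using 1
  simp only [mul_add, add_mul, mul_one, one_mul, Matrix.single_mul_single_same,
    Matrix.single_mul_single_of_ne _ _ _ _ hik.symm, add_zero]
  have : Matrix.single i i f + Matrix.single i i ((1 + f)⁻¹ - 1) +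
      Matrix.single i i (f * ((1 + f)⁻¹ - 1)) = (0 : Matrix (Fin n) (Fin n) (RatFunc ℂ)) := by
    rw [← Matrix.single_add, ← Matrix.single_add]
    convert Matrix.single_zero i i
    field_simp
    ring
  rw [← sub_eq_zero]
  refine Eq.trans ?_ (neg_eq_zero.2 this)
  abel

lemma one_add_sum_single_mem {n : ℕ} (k : Fin n) {x : Fin n → RatFunc ℂ}
    (hx : ∀ i, inftyVal (x i) < 1) (hx' : ∀ i, conjRatFunc (x i) = x i) :
    1 + ∑ i, Matrix.single i k (x i) ∈ simpleMatrices n := by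
  -- Cross terms `E_ak E_ik` vanish as `i ≠ k` for `i ∈ s`. The index `a` may be `k`, so the
  -- diagonal factor can be put on the left at the end.
  have step : ∀ (a : Fin n) (s : Finset (Fin n)), a ∉ s → k ∉ s →
      (1 + Matrix.single a k (x a)) * (1 + ∑ i ∈ s, Matrix.single i k (x i)) =
        1 + ∑ i ∈ insert a s, Matrix.single i k (x i) := by
    intro a s has hks
    have h0 : Matrix.single a k (x a) * ∑ i ∈ s, Matrix.single i k (x i) = 0 := by
      rw [Finset.mul_sum]
      refine Finset.sum_eq_zero fun i hi => ?_
      exact Matrix.single_mul_single_of_ne _ _ _ _ (fun h => hks (by rwa [h])) _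
    rw [Finset.sum_insert has, mul_add, mul_one, add_mul, h0, one_mul]
    abel
  have hs : ∀ s : Finset (Fin n), k ∉ s →
      1 + ∑ i ∈ s, Matrix.single i k (x i) ∈ simpleMatrices n := by
    intro s
    induction s using Finset.induction_on with
    | empty => intro _; simp
    | insert a s has ih =>
      intro hk
      rw [Finset.mem_insert, not_or] at hk
      rw [← step a s has hk.2]
      exact mul_mem (one_add_single_mem (Ne.symm hk.1) (hx a) (hx' a)) (ih hk.2)
  rw [← Finset.insert_erase (Finset.mem_univ k),
    ← step k _ (Finset.notMem_erase k _) (Finset.notMem_erase k _)]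
  exact mul_mem (one_add_single_self_mem k (hx k) (hx' k)) (hs _ (Finset.notMem_erase k _))

/-! ### Column elimination -/

lemma mem_simpleSubgroup_of_columns {n : ℕ} (m : ℕ) (hm : m ≤ n) :
    ∀ g ∈ loopGroupReal n,
      (∀ i j : Fin n, (j : ℕ) < m → (g : Matrix (Fin n) (Fin n) (RatFunc ℂ)) i j =
        (1 : Matrix (Fin n) (Fin n) (RatFunc ℂ)) i j) → g ∈ simpleSubgroup n := by
  induction hm using Nat.decreasingInduction with
  | self =>
    intro g _ h
    have : g = 1 := Units.ext (Matrix.ext fun i j => h i j j.2)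
    rw [this]
    exact one_mem _
  | of_succ m hm ih =>
    intro g hg h
    obtain ⟨hg1, hg2⟩ := mem_loopGroupReal_iff.1 hg
    let k : Fin n := ⟨m, hm⟩
    obtain ⟨s, hs, hsM⟩ := one_add_sum_single_mem k
      (x := fun i => ((g : Matrix (Fin n) (Fin n) (RatFunc ℂ)) - 1) i k) (fun i => hg1 i k)
      (fun i => by
        have h1 := congrFun (congrFun hg2 i) k
        rw [Matrix.map_apply] at h1
        rw [Matrix.sub_apply, map_sub, h1, Matrix.one_apply]
        split_ifs <;> simp)
    have hcol : ∀ i j : Fin n, (j : ℕ) < m + 1 →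
        (g : Matrix (Fin n) (Fin n) (RatFunc ℂ)) i j =
          (s : Matrix (Fin n) (Fin n) (RatFunc ℂ)) i j := by
      intro i j hj
      change (s : Matrix (Fin n) (Fin n) (RatFunc ℂ)) = _ at hsM
      rw [hsM, Matrix.add_apply, Matrix.sum_apply]
      rcases Nat.lt_succ_iff_lt_or_eq.1 hj with hj | hj
      · have hkj : k ≠ j := fun e => hj.ne (congrArg Fin.val e).symm
        rw [h i j hj, Finset.sum_eq_zero fun a _ => by simp [hkj], add_zero]
      · have hkj : j = k := Fin.ext hj
        subst hkj
        simp [Matrix.single_apply]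
    have key : s⁻¹ * g ∈ simpleSubgroup n := by
      refine ih _ (mul_mem (inv_mem (simpleSubgroup_le n hs)) hg) fun i j hj => ?_
      -- Writing `1` as `s⁻¹ s` reduces the claim to equality of the columns of `g` and `s`.
      rw [← Units.val_one, ← inv_mul_cancel s, Units.val_mul, Units.val_mul, Matrix.mul_apply,
        Matrix.mul_apply]
      exact Finset.sum_congr rfl fun a _ => by rw [hcol a j hj]
    simpa using mul_mem hs key

end RationalLoop

theorem mainTheorem3 (n : ℕ) :
    Subgroup.closure
        (RationalLoop.pLoops n ∪ RationalLoop.qLoops n ∪ RationalLoop.rLoops n) =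
      RationalLoop.loopGroupReal n :=
  le_antisymm (RationalLoop.simpleSubgroup_le n) fun g hg =>
    RationalLoop.mem_simpleSubgroup_of_columns 0 (Nat.zero_le n) g hg
      fun _ _ h => absurd h (Nat.not_lt_zero _)
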